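/- For real $X \ge 1$ let $$\Gamma(X)=\sum_{1\le n\le X}\mu^2(n^2+1)\,\mu^2(n^2+2)\,\mu^2(n^2+3),$$ where $n$ runs over the positive integers and $\mu$ is the Möbius function; thus $\Gamma(X)$ is the number of positive integers $n\le X$ for which $n^2+1$, $n^2+2$ and $n^2+3$ are all squarefree. Then there exist constants $\alpha>0.1477$ and $X_0$ such that $\Gamma(X)>\alpha X$ for all real $X\ge X_0$. -/

import Mathlib

open Filter

/-- `Γ(X) = ∑_{n ≤ X} μ²(n² + 1) μ²(n² + 2) μ²(n² + 3)`, for real `X`, where `n` runs over the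
positive integers and `μ` is the Möbius function. -/
noncomputable def squarefreeTripleSum (X : ℝ) : ℤ :=
  ∑ n ∈ Finset.Icc 1 ⌊X⌋₊,
    (ArithmeticFunction.moebius (n ^ 2 + 1)) ^ 2 * (ArithmeticFunction.moebius (n ^ 2 + 2)) ^ 2 *
      (ArithmeticFunction.moebius (n ^ 2 + 3)) ^ 2

/-!
For odd `n` the number `n² + 3` is divisible by `4`, so only `n = 2m` matters. No `4m² + a` with
`a ∈ {1, 2, 3}` is divisible by `4`; divisibility by `9` forces `a = 2` and divisibility by `25`
forces `a = 1`; and for an odd prime `p ∤ a` at most two residue classes of `m` modulo `p²` make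
`4m² + a` divisible by `p²`. The union bound therefore excludes a proportion of at most
`2/9 + 2/25 + 6 ∑_{p ≥ 7} 1/p² < 0.69` of the `m ≤ M`, up to an error of `O(1)` for each prime
`p ≤ 2M`, hence of `o(M)` by Chebyshev's bound on `π`. Half of the remaining `0.31` exceeds
`0.1477`.
-/

open Finset

section LocalRing

variable {R : Type*} [CommRing R] [IsLocalRing R]

lemma eq_or_eq_neg_of_sq_eq_sq_of_isUnit {x y : R} (hy : IsUnit (2 * y)) (h : x ^ 2 = y ^ 2) :
    x = y ∨ x = -y := by
  have hprod : (x + y) * (x - y) = 0 := by linear_combination h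
  have hsum : (x + y) + -(x - y) = 2 * y := by ring
  rcases IsLocalRing.isUnit_or_isUnit_of_isUnit_add (hsum ▸ hy) with hu | hu
  · exact .inl (sub_eq_zero.mp (hu.mul_right_eq_zero.mp hprod))
  · have hdiff : IsUnit (x - y) := (IsUnit.neg_iff _).mp hu
    exact .inr (eq_neg_of_add_eq_zero_left (hdiff.mul_left_eq_zero.mp hprod))

lemma card_mul_sq_add_eq_zero_le_two [Fintype R] [DecidableEq R] {c a : R}
    (h : IsUnit (2 * c * a)) : #{x : R | c * x ^ 2 + a = 0} ≤ 2 := by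
  obtain ⟨h2c, ha⟩ := IsUnit.mul_iff.mp h
  obtain ⟨h2, hc⟩ := IsUnit.mul_iff.mp h2c
  rcases Finset.eq_empty_or_nonempty {x : R | c * x ^ 2 + a = 0} with hempty | ⟨r, hr⟩
  · simp [hempty]
  have hr0 : c * r ^ 2 + a = 0 := by simpa using hr
  have hr_unit : IsUnit r := by
    have hcr : IsUnit (c * r ^ 2) := by
      rw [eq_neg_of_add_eq_zero_left hr0]
      exact ha.neg
    exact (isUnit_pow_iff two_ne_zero).mp (IsUnit.mul_iff.mp hcr).2
  refine (card_le_card fun x hx => ?_).trans (card_le_two (a := r) (b := -r))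
  have hx0 : c * x ^ 2 + a = 0 := by simpa using hx
  have hsq : x ^ 2 = r ^ 2 := hc.mul_left_cancel (by linear_combination hx0 - hr0)
  simpa using eq_or_eq_neg_of_sq_eq_sq_of_isUnit (h2.mul hr_unit) hsq

end LocalRing

lemma isLocalRing_zmod_prime_pow (p : ℕ) [Fact p.Prime] {k : ℕ} (hk : k ≠ 0) :
    IsLocalRing (ZMod (p ^ k)) :=
  have : Fact (1 < p ^ k) := ⟨Nat.one_lt_pow hk (Fact.out : p.Prime).one_lt⟩
  .of_surjective' (PadicInt.toZModPow k) (ZMod.ringHom_surjective _)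

section Counting

variable (M : ℕ) {q : ℕ} [NeZero q]

lemma card_filter_natCast_eq_le (x : ZMod q) :
    #{m ∈ Ioc 0 M | ((m : ℕ) : ZMod q) = x} ≤ M / q + 1 :=
  calc #{m ∈ Ioc 0 M | ((m : ℕ) : ZMod q) = x}
      ≤ #{m ∈ range M | m ≡ (x - 1).val [MOD q]} := by
        refine card_le_card_of_injOn (· - 1) (fun m hm => ?_) fun a ha b hb hab => ?_
        · obtain ⟨⟨hm0, hmM⟩, rfl⟩ : (0 < m ∧ m ≤ M) ∧ (m : ZMod q) = x := by simpa using hm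
          have hm1 : m - 1 < M := by omega
          simpa [← ZMod.natCast_eq_natCast_iff, Nat.cast_pred hm0] using hm1
        · simp only [coe_filter, mem_Ioc, Set.mem_ofPred_eq] at ha hb
          grind
    _ = M.count (· ≡ (x - 1).val [MOD q]) := (Nat.count_eq_card_filter_range _ _).symm
    _ ≤ M / q + 1 := by
        rw [Nat.count_modEq_card _ (NeZero.pos q)]
        split_ifs <;> simp

lemma card_filter_natCast_mem_le (s : Finset (ZMod q)) :
    #{m ∈ Ioc 0 M | ((m : ℕ) : ZMod q) ∈ s} ≤ #s * (M / q + 1) := by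
  have hfiber : {m ∈ Ioc 0 M | ((m : ℕ) : ZMod q) ∈ s} =
      s.biUnion fun x => {m ∈ Ioc 0 M | ((m : ℕ) : ZMod q) = x} := by
    ext m
    grind
  rw [hfiber]
  exact card_biUnion_le_card_mul _ _ _ fun x _ => card_filter_natCast_eq_le M x

lemma card_filter_dvd_mul_sq_add_le (c a : ℕ) :
    #{m ∈ Ioc 0 M | q ∣ c * m ^ 2 + a} ≤ #{x : ZMod q | c * x ^ 2 + a = 0} * (M / q + 1) := by
  have hroots (m : ℕ) :
      q ∣ c * m ^ 2 + a ↔ (m : ZMod q) ∈ ({x | c * x ^ 2 + a = 0} : Finset (ZMod q)) := by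
    rw [← ZMod.natCast_eq_zero_iff]
    simp
  simpa only [hroots] using card_filter_natCast_mem_le M _

end Counting

lemma card_filter_prime_pow_dvd_mul_sq_add_le {p k c a : ℕ} (hp : p.Prime) (hk : k ≠ 0)
    (h : ¬ p ∣ 2 * c * a) (M : ℕ) :
    #{m ∈ Ioc 0 M | p ^ k ∣ c * m ^ 2 + a} ≤ 2 * (M / p ^ k + 1) := by
  have : Fact p.Prime := ⟨hp⟩
  have := isLocalRing_zmod_prime_pow p hk
  have hunit : IsUnit (2 * c * a : ZMod (p ^ k)) := by
    exact_mod_cast (ZMod.isUnit_natCast_iff_not_dvd_pow hp (Nat.pos_of_ne_zero hk)).mpr h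
  exact (card_filter_dvd_mul_sq_add_le M c a).trans
    (Nat.mul_le_mul_right _ (card_mul_sq_add_eq_zero_le_two hunit))

lemma card_filter_exists_pow_dvd_mul_sq_add_le {T : Finset (ℕ × ℕ)} {k c : ℕ} (hk : k ≠ 0)
    (hT : ∀ t ∈ T, t.1.Prime ∧ ¬ t.1 ∣ 2 * c * t.2) (M : ℕ) :
    (#{m ∈ Ioc 0 M | ∃ t ∈ T, t.1 ^ k ∣ c * m ^ 2 + t.2} : ℝ) ≤
      2 * M * ∑ t ∈ T, ((t.1 : ℝ) ^ k)⁻¹ + 2 * #T := by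
  have hunion : {m ∈ Ioc 0 M | ∃ t ∈ T, t.1 ^ k ∣ c * m ^ 2 + t.2} =
      T.biUnion fun t => {m ∈ Ioc 0 M | t.1 ^ k ∣ c * m ^ 2 + t.2} := by
    ext m
    simp only [mem_filter, mem_biUnion]
    tauto
  have hbound (t) (ht : t ∈ T) : (#{m ∈ Ioc 0 M | t.1 ^ k ∣ c * m ^ 2 + t.2} : ℝ) ≤
      2 * M * ((t.1 : ℝ) ^ k)⁻¹ + 2 := by
    have hcard := card_filter_prime_pow_dvd_mul_sq_add_le (hT t ht).1 hk (hT t ht).2 M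
    have hdiv : ((M / t.1 ^ k : ℕ) : ℝ) ≤ M / (t.1 : ℝ) ^ k := by
      exact_mod_cast Nat.cast_div_le (α := ℝ)
    calc (#{m ∈ Ioc 0 M | t.1 ^ k ∣ c * m ^ 2 + t.2} : ℝ)
        ≤ 2 * ((M / t.1 ^ k : ℕ) + 1) := by exact_mod_cast hcard
      _ ≤ 2 * (M / (t.1 : ℝ) ^ k + 1) := by gcongr
      _ = 2 * M * ((t.1 : ℝ) ^ k)⁻¹ + 2 := by ring
  calc (#{m ∈ Ioc 0 M | ∃ t ∈ T, t.1 ^ k ∣ c * m ^ 2 + t.2} : ℝ)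
      ≤ ∑ t ∈ T, (#{m ∈ Ioc 0 M | t.1 ^ k ∣ c * m ^ 2 + t.2} : ℝ) := by
        rw [hunion]
        exact_mod_cast card_biUnion_le
    _ ≤ ∑ t ∈ T, (2 * M * ((t.1 : ℝ) ^ k)⁻¹ + 2) := sum_le_sum hbound
    _ = 2 * M * ∑ t ∈ T, ((t.1 : ℝ) ^ k)⁻¹ + 2 * #T := by
        rw [sum_add_distrib, ← mul_sum, sum_const, nsmul_eq_mul, mul_comm (#T : ℝ)]

lemma primeCounting_isLittleO_natCast :
    (fun n : ℕ => (n.primeCounting : ℝ)) =o[atTop] fun n : ℕ => (n : ℝ) := by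
  have hbigO : (fun x : ℝ => (⌊x⌋₊.primeCounting : ℝ)) =O[atTop] fun x => x * (Real.log x)⁻¹ := by
    refine .of_bound (Real.log 4 + 1) ?_
    filter_upwards [Chebyshev.eventually_primeCounting_le one_pos, eventually_ge_atTop 1]
      with x hx hx1
    have hlog : 0 ≤ Real.log x := Real.log_nonneg hx1
    rwa [Real.norm_of_nonneg (by positivity), Real.norm_of_nonneg (by positivity),
      ← div_eq_mul_inv, ← mul_div_assoc]
  have hlittleO : (fun x : ℝ => x * (Real.log x)⁻¹) =o[atTop] fun x => x := by
    simpa using (Asymptotics.isBigO_refl (fun x : ℝ => x) atTop).mul_isLittleO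
      Real.inv_log_isLittleO_one
  simpa [Function.comp_def] using
    (hbigO.trans_isLittleO hlittleO).comp_tendsto tendsto_natCast_atTop_atTop

/-- The primes `p` with `7 ≤ p ≤ N`. -/
def primesFromSeven (N : ℕ) : Finset ℕ := {p ∈ Ioc 6 N | p.Prime}

lemma mem_primesFromSeven {N p : ℕ} : p ∈ primesFromSeven N ↔ (6 < p ∧ p ≤ N) ∧ p.Prime := by
  rw [primesFromSeven, mem_filter, mem_Ioc]

lemma card_primesFromSeven_le_primeCounting (N : ℕ) : #(primesFromSeven N) ≤ N.primeCounting := by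
  rw [← Nat.primesLE_card_eq_primeCounting]
  exact card_le_card fun p hp =>
    Nat.mem_primesLE.mpr ⟨(mem_primesFromSeven.mp hp).1.2, (mem_primesFromSeven.mp hp).2⟩

lemma sum_primesFromSeven_inv_sq_le (N : ℕ) :
    ∑ p ∈ primesFromSeven N, ((p : ℝ) ^ 2)⁻¹ ≤ 0.0646 := by
  have hsplit : primesFromSeven N ⊆ primesFromSeven 60 ∪ Ioc 60 (max 60 N) := fun p hp => by
    simp only [mem_union, mem_primesFromSeven, mem_Ioc] at hp ⊢
    grind
  have hdisj : Disjoint (primesFromSeven 60) (Ioc 60 (max 60 N)) :=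
    disjoint_left.mpr fun p hp hp' => by
      simp only [mem_primesFromSeven, mem_Ioc] at hp hp'
      omega
  have hhead : ∑ p ∈ primesFromSeven 60, ((p : ℝ) ^ 2)⁻¹ ≤ 0.04791 := by
    rw [show primesFromSeven 60 = {7, 11, 13, 17, 19, 23, 29, 31, 37, 41, 43, 47, 53, 59} by
      decide]
    norm_num
  have htail : ∑ p ∈ Ioc 60 (max 60 N), ((p : ℝ) ^ 2)⁻¹ ≤ (60 : ℝ)⁻¹ :=
    (sum_Ioc_inv_sq_le_sub (by norm_num) (le_max_left 60 N)).trans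
      (sub_le_self _ (by positivity))
  calc ∑ p ∈ primesFromSeven N, ((p : ℝ) ^ 2)⁻¹
      ≤ ∑ p ∈ primesFromSeven 60 ∪ Ioc 60 (max 60 N), ((p : ℝ) ^ 2)⁻¹ :=
        sum_le_sum_of_subset_of_nonneg hsplit fun _ _ _ => by positivity
    _ = ∑ p ∈ primesFromSeven 60, ((p : ℝ) ^ 2)⁻¹ +
          ∑ p ∈ Ioc 60 (max 60 N), ((p : ℝ) ^ 2)⁻¹ := sum_union hdisj
    _ ≤ 0.0646 := by linarith

/-- The pairs `(p, a)`, with `p ≤ N` once `p ≥ 7`, for which `p ^ 2` can divide `n ^ 2 + a` for some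
even `n` and `a ∈ {1, 2, 3}`. -/
def squareObstructions (N : ℕ) : Finset (ℕ × ℕ) :=
  {(3, 2), (5, 1)} ∪ primesFromSeven N ×ˢ Icc 1 3

lemma eq_two_of_three_sq_dvd {m a : ℕ} (ha : a ∈ Icc 1 3) (h : 3 ^ 2 ∣ 4 * m ^ 2 + a) : a = 2 := by
  have hmod : ∀ x : ZMod (3 ^ 2), 4 * x ^ 2 + 1 ≠ 0 ∧ 4 * x ^ 2 + 3 ≠ 0 := by decide
  rw [← ZMod.natCast_eq_zero_iff] at h
  push_cast at h
  fin_cases ha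
  · exact absurd (by simpa using h) (hmod m).1
  · rfl
  · exact absurd (by simpa using h) (hmod m).2

lemma eq_one_of_five_sq_dvd {m a : ℕ} (ha : a ∈ Icc 1 3) (h : 5 ^ 2 ∣ 4 * m ^ 2 + a) : a = 1 := by
  have hmod : ∀ x : ZMod 5, 4 * x ^ 2 + 2 ≠ 0 ∧ 4 * x ^ 2 + 3 ≠ 0 := by decide
  have h5 := (dvd_pow_self 5 two_ne_zero).trans h
  rw [← ZMod.natCast_eq_zero_iff] at h5
  push_cast at h5
  fin_cases ha
  · rfl
  · exact absurd (by simpa using h5) (hmod m).1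
  · exact absurd (by simpa using h5) (hmod m).2

lemma mem_squareObstructions_of_sq_dvd {M m a p : ℕ} (hm : m ∈ Ioc 0 M) (ha : a ∈ Icc 1 3)
    (hp : p.Prime) (h : p ^ 2 ∣ 4 * m ^ 2 + a) : (p, a) ∈ squareObstructions (2 * M) := by
  obtain ⟨hm0, hmM⟩ := mem_Ioc.mp hm
  obtain ⟨ha1, ha3⟩ := mem_Icc.mp ha
  rcases le_or_gt p 6 with hp6 | hp6
  · have hp' : p = 2 ∨ p = 3 ∨ p = 5 := by
      interval_cases p <;> revert hp <;> decide
    rcases hp' with rfl | rfl | rfl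
    · have h4 : 4 ∣ a := (Nat.dvd_add_right (dvd_mul_right 4 _)).mp h
      exact absurd (Nat.le_of_dvd ha1 h4) (by omega)
    · simp [squareObstructions, eq_two_of_three_sq_dvd ha h]
    · simp [squareObstructions, eq_one_of_five_sq_dvd ha h]
  · have hpM : p ≤ 2 * M := by
      have hle : p ^ 2 ≤ 4 * m ^ 2 + a := Nat.le_of_dvd (by omega) h
      by_contra! hlt
      have hsq : (2 * m + 1) ^ 2 ≤ p ^ 2 := Nat.pow_le_pow_left (by omega) 2
      nlinarith only [hle, hsq, hm0, ha3]
    exact mem_union_right _ (mem_product.mpr ⟨mem_primesFromSeven.mpr ⟨⟨hp6, hpM⟩, hp⟩, ha⟩)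

lemma prime_and_not_dvd_of_mem_squareObstructions {N : ℕ} {t : ℕ × ℕ}
    (ht : t ∈ squareObstructions N) : t.1.Prime ∧ ¬ t.1 ∣ 2 * 4 * t.2 := by
  obtain ⟨p, a⟩ := t
  simp only [squareObstructions, mem_union, mem_insert, mem_singleton, Prod.mk.injEq, mem_product,
    mem_primesFromSeven, mem_Icc] at ht
  rcases ht with (⟨rfl, rfl⟩ | ⟨rfl, rfl⟩) | ⟨⟨⟨hp6, -⟩, hp⟩, ha1, ha3⟩
  · norm_num
  · norm_num
  · refine ⟨hp, fun h => ?_⟩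
    rcases hp.dvd_mul.mp h with h8 | ha
    · have hp2 : p ≤ 2 := Nat.le_of_dvd two_pos (hp.dvd_of_dvd_pow (show p ∣ 2 ^ 3 from h8))
      omega
    · have hpa : p ≤ a := Nat.le_of_dvd ha1 ha
      omega

lemma disjoint_pair_primesFromSeven_product (N : ℕ) :
    Disjoint {(3, 2), (5, 1)} (primesFromSeven N ×ˢ Icc 1 3) := by
  simp [mem_primesFromSeven]

lemma sum_squareObstructions_inv_sq_le (N : ℕ) :
    ∑ t ∈ squareObstructions N, ((t.1 : ℝ) ^ 2)⁻¹ ≤ 0.345 := by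
  have hsum : ∑ t ∈ squareObstructions N, ((t.1 : ℝ) ^ 2)⁻¹ =
      (3 ^ 2)⁻¹ + (5 ^ 2)⁻¹ + 3 * ∑ p ∈ primesFromSeven N, ((p : ℝ) ^ 2)⁻¹ := by
    rw [squareObstructions, sum_union (disjoint_pair_primesFromSeven_product N), sum_pair (by simp),
      sum_product]
    simp [mul_sum]
  rw [hsum]
  linarith [sum_primesFromSeven_inv_sq_le N]

lemma card_squareObstructions_le (N : ℕ) :
    #(squareObstructions N) ≤ 2 + 3 * N.primeCounting := by
  have hprimes := card_primesFromSeven_le_primeCounting N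
  have hunion := card_union_le {(3, 2), (5, 1)} (primesFromSeven N ×ˢ Icc 1 3)
  rw [card_product, Nat.card_Icc, card_pair (by simp)] at hunion
  rw [squareObstructions]
  omega

/-- `n ^ 2 + 1`, `n ^ 2 + 2` and `n ^ 2 + 3` are all squarefree. -/
abbrev IsSquarefreeTriple (n : ℕ) : Prop := ∀ a ∈ Icc 1 3, Squarefree (n ^ 2 + a)

lemma squarefreeTripleSum_eq_card (X : ℝ) :
    squarefreeTripleSum X = #{n ∈ Icc 1 ⌊X⌋₊ | IsSquarefreeTriple n} := by
  have hterm (n : ℕ) : IsSquarefreeTriple n ↔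
      Squarefree (n ^ 2 + 1) ∧ Squarefree (n ^ 2 + 2) ∧ Squarefree (n ^ 2 + 3) := by
    rw [IsSquarefreeTriple, show Icc 1 3 = {1, 2, 3} by decide]
    simp
  simp only [squarefreeTripleSum, ArithmeticFunction.moebius_sq, card_filter, hterm, ite_and,
    Nat.cast_sum]
  congr! with n
  split_ifs <;> simp

lemma card_isSquarefreeTriple_two_mul_le_squarefreeTripleSum (X : ℝ) :
    (#{m ∈ Ioc 0 ⌊X / 2⌋₊ | IsSquarefreeTriple (2 * m)} : ℤ) ≤ squarefreeTripleSum X := by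
  rw [squarefreeTripleSum_eq_card, Nat.cast_le]
  refine card_le_card_of_injOn (2 * ·) (fun m hm => ?_) fun a _ b _ h => by simpa using h
  obtain ⟨hmIoc, htriple⟩ := mem_filter.mp hm
  obtain ⟨hm0, hmX⟩ := mem_Ioc.mp hmIoc
  have hle : m ≤ X / 2 := (Nat.le_floor_iff' hm0.ne').mp hmX
  have hfloor : 2 * m ≤ ⌊X⌋₊ := Nat.le_floor (by push_cast; linarith)
  exact mem_filter.mpr ⟨mem_Icc.mpr ⟨Nat.mul_pos two_pos hm0, hfloor⟩, htriple⟩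

lemma exists_sq_dvd_of_not_isSquarefreeTriple {M m : ℕ} (hm : m ∈ Ioc 0 M)
    (h : ¬ IsSquarefreeTriple (2 * m)) :
    ∃ t ∈ squareObstructions (2 * M), t.1 ^ 2 ∣ 4 * m ^ 2 + t.2 := by
  simp only [IsSquarefreeTriple, not_forall, Nat.squarefree_iff_prime_squarefree, not_not] at h
  obtain ⟨a, ha, p, hp, hdvd⟩ := h
  have hdvd' : p ^ 2 ∣ 4 * m ^ 2 + a := by convert hdvd using 1 <;> ring
  exact ⟨(p, a), mem_squareObstructions_of_sq_dvd hm ha hp hdvd', hdvd'⟩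

lemma card_isSquarefreeTriple_two_mul_ge (M : ℕ) :
    0.31 * (M : ℝ) - (4 + 6 * (2 * M).primeCounting) ≤
      #{m ∈ Ioc 0 M | IsSquarefreeTriple (2 * m)} := by
  have htotal : (#{m ∈ Ioc 0 M | IsSquarefreeTriple (2 * m)} : ℝ) +
      #{m ∈ Ioc 0 M | ¬ IsSquarefreeTriple (2 * m)} = M := by
    exact_mod_cast (card_filter_add_card_filter_not _).trans (Nat.card_Ioc 0 M)
  have hbad : (#{m ∈ Ioc 0 M | ¬ IsSquarefreeTriple (2 * m)} : ℝ) ≤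
      0.69 * M + (4 + 6 * (2 * M).primeCounting) :=
    calc (#{m ∈ Ioc 0 M | ¬ IsSquarefreeTriple (2 * m)} : ℝ)
        ≤ #{m ∈ Ioc 0 M | ∃ t ∈ squareObstructions (2 * M), t.1 ^ 2 ∣ 4 * m ^ 2 + t.2} := by
          exact_mod_cast card_le_card fun m hm => mem_filter.mpr ⟨(mem_filter.mp hm).1,
            exists_sq_dvd_of_not_isSquarefreeTriple (mem_filter.mp hm).1 (mem_filter.mp hm).2⟩
      _ ≤ 2 * M * ∑ t ∈ squareObstructions (2 * M), ((t.1 : ℝ) ^ 2)⁻¹ +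
            2 * #(squareObstructions (2 * M)) :=
          card_filter_exists_pow_dvd_mul_sq_add_le two_ne_zero
            (fun _ => prime_and_not_dvd_of_mem_squareObstructions) M
      _ ≤ 2 * M * 0.345 + 2 * (2 + 3 * (2 * M).primeCounting) := by
          gcongr
          · exact sum_squareObstructions_inv_sq_le _
          · exact_mod_cast card_squareObstructions_le _
      _ = 0.69 * M + (4 + 6 * (2 * M).primeCounting) := by ring
  linarith

lemma eventually_card_isSquarefreeTriple_two_mul_ge {δ : ℝ} (hδ : δ < 0.31) :
    ∀ᶠ M : ℕ in atTop, δ * M ≤ #{m ∈ Ioc 0 M | IsSquarefreeTriple (2 * m)} := by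
  have herror : (fun M : ℕ => 4 + 6 * ((2 * M).primeCounting : ℝ)) =o[atTop]
      fun M : ℕ => (M : ℝ) := by
    have hconst : (fun _ : ℕ => (4 : ℝ)) =o[atTop] fun M : ℕ => (M : ℝ) :=
      Asymptotics.isLittleO_const_left.mpr
        (.inr (tendsto_norm_atTop_atTop.comp tendsto_natCast_atTop_atTop))
    have hdouble : Tendsto (2 * · : ℕ → ℕ) atTop atTop := tendsto_id.const_mul_atTop' two_pos
    have hprimes : (fun M : ℕ => ((2 * M).primeCounting : ℝ)) =o[atTop]
        fun M : ℕ => 2 * (M : ℝ) := by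
      simpa [Function.comp_def] using primeCounting_isLittleO_natCast.comp_tendsto hdouble
    exact hconst.add (hprimes.of_const_mul_right.const_mul_left 6)
  filter_upwards [herror.bound (sub_pos.mpr hδ)] with M hM
  rw [Real.norm_of_nonneg (by positivity), Real.norm_of_nonneg (by positivity)] at hM
  linarith [card_isSquarefreeTriple_two_mul_ge M]

theorem mainTheorem3 :
    ∃ α : ℝ, 0.1477 < α ∧ ∀ᶠ X : ℝ in atTop, α * X < (squarefreeTripleSum X : ℝ) := by
  refine ⟨0.15, by norm_num, ?_⟩
  have hhalf : Tendsto (fun X : ℝ => ⌊X / 2⌋₊) atTop atTop :=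
    tendsto_nat_floor_atTop.comp (tendsto_id.atTop_div_const two_pos)
  filter_upwards [hhalf.eventually
    (eventually_card_isSquarefreeTriple_two_mul_ge (δ := 0.305) (by norm_num)),
    eventually_gt_atTop 200] with X hcard hX
  have hfloor : X / 2 - 1 < ⌊X / 2⌋₊ := Nat.sub_one_lt_floor _
  calc 0.15 * X < 0.305 * ⌊X / 2⌋₊ := by linarith
    _ ≤ #{m ∈ Ioc 0 ⌊X / 2⌋₊ | IsSquarefreeTriple (2 * m)} := hcard
    _ ≤ squarefreeTripleSum X := by
        exact_mod_cast card_isSquarefreeTriple_two_mul_le_squarefreeTripleSum X
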